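/- A \emph{BZ-lattice} is an algebra $(L,\wedge,\vee,{}',{}^{\sim},0,1)$ such that $(L,\wedge,\vee,0,1)$ is a bounded lattice; ${}'$ is order-reversing with $a''=a$ and $a\wedge a'\le b\vee b'$; and ${}^{\sim}$ is order-reversing with $a\wedge a^{\sim}=0$ and $a\le a^{\sim\sim}=a^{\sim\prime}$, for all $a,b\in L$. A \emph{PBZ$^*$-lattice} is a BZ-lattice in which $a\le b$ and $a'\wedge b=0$ imply $a=b$ (paraorthomodularity), and which satisfies $(x\wedge x')^{\sim}= x^{\sim}\vee x'^{\sim}$. An \emph{antiortholattice} is a PBZ$^*$-lattice $L$ with $\{x\in L: x\vee x'=1\}=\{0,1\}$. Let $\mathbb{PBZL}^*$ and $\mathbb{AOL}$ be the classes of PBZ$^*$-lattices and of antiortholattices. A \emph{variety} of BZ-lattices is a class of BZ-lattices closed under homomorphic images, subalgebras and direct products, and $V(\mathbb{C})=\mathrm{HSP}(\mathbb{C})$ denotes the variety generated by a class $\mathbb{C}$. Let $\mathrm{Subvar}(\mathbb{PBZL}^*)$ be the set of varieties contained in $\mathbb{PBZL}^*$, ordered by inclusion. For $n\ge 1$ let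 $\mathbf{D}_n$ be the $n$-element chain with its order-reversing involution ${}'$ and with $0^{\sim}=1$, $a^{\sim}=0$ for $a\neq 0$. \textbf{Theorem.} $V(\mathbf{D}_3)$ and $V(\mathbf{D}_4)$ belong to $\mathrm{Subvar}(\mathbb{PBZL}^*)$, and $V(\mathbf{D}_4)$ is the only cover of $V(\mathbf{D}_3)$ in $\mathrm{Subvar}(\mathbb{PBZL}^*)$ that is included in $V(\mathbb{AOL})$; that is, a subvariety $\mathbb{W}$ of $\mathbb{PBZL}^*$ is a cover of $V(\mathbf{D}_3)$ in $\mathrm{Subvar}(\mathbb{PBZL}^*)$ with $\mathbb{W}\subseteq V(\mathbb{AOL})$ if and only if $\mathbb{W}=V(\mathbf{D}_4)$. -/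

import Mathlib

universe u

namespace PBZ

/-- A Brouwer-Zadeh lattice: a bounded lattice with a Kleene complement `kneg` making it a
pseudo-Kleene algebra, and a Brouwer complement `bneg`. -/
class BZLattice (α : Type u) extends Lattice α, BoundedOrder α where
  /-- the Kleene complement -/
  kneg : α → α
  /-- the Brouwer complement -/
  bneg : α → α
  kneg_antitone : ∀ a b : α, a ≤ b → kneg b ≤ kneg a
  kneg_kneg : ∀ a : α, kneg (kneg a) = a
  kleene : ∀ a b : α, a ⊓ kneg a ≤ b ⊔ kneg b
  bneg_antitone : ∀ a b : α, a ≤ b → bneg b ≤ bneg a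
  inf_bneg : ∀ a : α, a ⊓ bneg a = ⊥
  le_bneg_bneg : ∀ a : α, a ≤ bneg (bneg a)
  bneg_bneg : ∀ a : α, bneg (bneg a) = kneg (bneg a)

/-- Homomorphisms of BZ-lattices: maps preserving all six operations. -/
structure IsHom {α β : Type u} [BZLattice α] [BZLattice β] (f : α → β) : Prop where
  map_inf : ∀ a b, f (a ⊓ b) = f a ⊓ f b
  map_sup : ∀ a b, f (a ⊔ b) = f a ⊔ f b
  map_kneg : ∀ a, f (BZLattice.kneg a) = BZLattice.kneg (f a)
  map_bneg : ∀ a, f (BZLattice.bneg a) = BZLattice.bneg (f a)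
  map_bot : f ⊥ = ⊥
  map_top : f ⊤ = ⊤

/-- The direct product of a family of BZ-lattices, with componentwise operations. -/
instance instBZLatticePi {ι : Type u} (A : ι → Type u) [∀ i, BZLattice (A i)] :
    BZLattice (∀ i, A i) where
  toLattice := inferInstance
  toBoundedOrder := inferInstance
  kneg a := fun i => BZLattice.kneg (a i)
  bneg a := fun i => BZLattice.bneg (a i)
  kneg_antitone _ _ h := fun i => BZLattice.kneg_antitone _ _ (h i)
  kneg_kneg a := funext fun i => BZLattice.kneg_kneg (a i)
  kleene a b := fun i => BZLattice.kleene (a i) (b i)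
  bneg_antitone _ _ h := fun i => BZLattice.bneg_antitone _ _ (h i)
  inf_bneg a := funext fun i => BZLattice.inf_bneg (a i)
  le_bneg_bneg a := fun i => BZLattice.le_bneg_bneg (a i)
  bneg_bneg a := funext fun i => BZLattice.bneg_bneg (a i)

/-- The class `𝔹ℤ𝕃` of all BZ-lattices (with universe in `Type u`). -/
structure BZL : Type (u + 1) where
  /-- the universe of the algebra -/
  carrier : Type u
  [str : BZLattice carrier]

instance : CoeSort BZL.{u} (Type u) := ⟨BZL.carrier⟩

instance (A : BZL.{u}) : BZLattice A := A.str

/-- Homomorphic images of members of `K`. -/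
def H (K : Set BZL.{u}) : Set BZL.{u} :=
  {B | ∃ A ∈ K, ∃ f : A → B, IsHom f ∧ Function.Surjective f}

/-- Algebras isomorphic to subalgebras of members of `K`. -/
def S (K : Set BZL.{u}) : Set BZL.{u} :=
  {B | ∃ A ∈ K, ∃ f : B → A, IsHom f ∧ Function.Injective f}

/-- Direct products of (possibly empty) families of members of `K`. -/
def P (K : Set BZL.{u}) : Set BZL.{u} :=
  {B | ∃ (ι : Type u) (A : ι → BZL.{u}), (∀ i, A i ∈ K) ∧ B = BZL.mk (∀ i, A i)}

/-- The variety `V(K) = HSP(K)` generated by `K`. -/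
def V (K : Set BZL.{u}) : Set BZL.{u} := H (S (P K))

/-- A variety of BZ-lattices: a class closed under homomorphic images, subalgebras and direct
products (so nonempty, as it contains the empty product). -/
def IsVariety (K : Set BZL.{u}) : Prop := H K ⊆ K ∧ S K ⊆ K ∧ P K ⊆ K

/-- The subvarieties of `K`, ordered by inclusion. -/
abbrev Subvar (K : Set BZL.{u}) : Type (u + 1) :=
  {W : Set BZL.{u} // IsVariety W ∧ W ⊆ K}

/-- The class `ℙ𝔹ℤ𝕃*` of PBZ*-lattices: the paraorthomodular BZ-lattices satisfying
`(x ∧ x')~ = x~ ∨ x'~`. -/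
def PBZLStar : Set BZL.{u} :=
  {L | (∀ a b : L, a ≤ b → BZLattice.kneg a ⊓ b = ⊥ → a = b) ∧
    ∀ a : L, BZLattice.bneg (a ⊓ BZLattice.kneg a) =
      BZLattice.bneg a ⊔ BZLattice.bneg (BZLattice.kneg a)}

/-- The set of sharp elements of a BZ-lattice. -/
def sharp (L : BZL.{u}) : Set L := {x | x ⊔ BZLattice.kneg x = ⊤}

/-- The class `𝔸𝕆𝕃` of antiortholattices: the PBZ*-lattices whose only sharp elements are
`0` and `1`. -/
def AOL : Set BZL.{u} := {L | L ∈ PBZLStar ∧ sharp L = {⊥, ⊤}}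

/-- The BZ-lattice on the chain `0 < 1 < ⋯ < n - 1`, with the order-reversing
involution and the trivial Brouwer complement. -/
instance instBZLatticeFin (n : ℕ) [NeZero n] : BZLattice (ULift.{u} (Fin n)) where
  toLattice := inferInstance
  bot := ULift.up 0
  top := ULift.up (Fin.rev 0)
  bot_le a := Fin.zero_le a.down
  le_top a := by
    change a.down ≤ Fin.rev 0
    simp only [Fin.le_def, Fin.val_rev, Fin.val_zero]
    omega
  kneg a := ULift.up a.down.rev
  bneg a := if a.down = 0 then ULift.up (Fin.rev 0) else ULift.up 0
  kneg_antitone a b h := by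
    change b.down.rev ≤ a.down.rev
    exact Fin.rev_le_rev.mpr h
  kneg_kneg a := by simp
  kleene a b := by
    change a.down ⊓ a.down.rev ≤ b.down ⊔ b.down.rev
    simp only [inf_le_iff, le_sup_iff, Fin.le_def, Fin.val_rev]
    omega
  bneg_antitone a b h := by
    by_cases hb : b.down = 0
    · have ha : a.down = 0 := le_antisymm (hb ▸ h) (Fin.zero_le _)
      simp [ha, hb]
    · simp only [hb, if_false]
      exact Fin.zero_le _
  inf_bneg a := by
    apply ULift.ext
    by_cases ha : a.down = 0
    · change a.down ⊓ _ = 0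
      rw [ha]
      exact inf_eq_left.mpr (Fin.zero_le _)
    · change a.down ⊓ (if a.down = 0 then ULift.up (Fin.rev 0) else ULift.up 0).down = 0
      rw [if_neg ha]
      exact inf_eq_right.mpr (Fin.zero_le _)
  le_bneg_bneg a := by
    by_cases ha : a.down = 0
    · change a.down ≤ _
      rw [ha]
      exact Fin.zero_le _
    · simp only [ha, if_false, if_true]
      change a.down ≤ Fin.rev 0
      simp only [Fin.le_def, Fin.val_rev, Fin.val_zero]
      omega
  bneg_bneg a := by
    by_cases ha : a.down = 0
    · by_cases h1 : Fin.rev (0 : Fin n) = 0 <;> simp [ha, h1]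
    · simp [ha]

/-- The `n`-element chain as a BZ-lattice. -/
def D (n : ℕ) [NeZero n] : BZL.{u} := BZL.mk (ULift.{u} (Fin n))

end PBZ

/-! It suffices that every variety `W` of PBZ*-lattices inside `V AOL` that is not below `V {D 3}`
contains `D 4`; then `V {D 4}` is the least variety strictly above `V {D 3}` within `V AOL`.

A subvariety of `V AOL` is determined by its antiortholattices. In an antiortholattice every `bneg
y` is `⊥` or `⊤`, so the identities `BnegCentral`, which make `bneg y` split an algebra, hold there
and hence throughout `V AOL`. A congruence maximal among those separating two given points therefore
has a quotient with only trivial Brouwer complements (`BnegCentral.exists_congruence`). That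
quotient stays in `W`, so it is a PBZ*-lattice and hence an antiortholattice
(`subset_of_inter_AOL_subset`).

For an antiortholattice there is a dichotomy. If `⊥ ≠ y < kneg y`, then `⊥, y, kneg y, ⊤` form a
copy of `D 4`. Otherwise every nontrivial element is fixed by `kneg`, the Kleene condition allows at
most one such element, and the algebra lies in `V {D 3}`. -/

namespace PBZ

open BZLattice

/-! ### Arithmetic of the two complements. -/

section Basic

variable {α : Type u} [BZLattice α]

theorem kneg_le_comm {a b : α} (h : kneg a ≤ b) : kneg b ≤ a := by
  simpa [kneg_kneg] using kneg_antitone _ _ h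

theorem le_kneg_comm {a b : α} (h : a ≤ kneg b) : b ≤ kneg a := by
  simpa [kneg_kneg] using kneg_antitone _ _ h

theorem kneg_sup (a b : α) : kneg (a ⊔ b) = kneg a ⊓ kneg b :=
  le_antisymm (le_inf (kneg_antitone _ _ le_sup_left) (kneg_antitone _ _ le_sup_right))
    (le_kneg_comm (sup_le (le_kneg_comm inf_le_left) (le_kneg_comm inf_le_right)))

theorem kneg_inf (a b : α) : kneg (a ⊓ b) = kneg a ⊔ kneg b := by
  rw [← kneg_kneg (kneg a ⊔ kneg b), kneg_sup, kneg_kneg, kneg_kneg]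

theorem kneg_injective : Function.Injective (kneg : α → α) :=
  Function.LeftInverse.injective kneg_kneg

@[simp] theorem kneg_bot : kneg (⊥ : α) = ⊤ :=
  top_le_iff.mp (le_kneg_comm bot_le)

@[simp] theorem kneg_top : kneg (⊤ : α) = ⊥ :=
  le_bot_iff.mp (kneg_le_comm le_top)

@[simp] theorem bneg_top : bneg (⊤ : α) = ⊥ := by
  simpa using inf_bneg (⊤ : α)

@[simp] theorem bneg_bot : bneg (⊥ : α) = ⊤ := by
  have h := bneg_bneg (⊤ : α)
  simpa using h

theorem bneg_le_kneg (a : α) : bneg a ≤ kneg a :=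
  le_kneg_comm ((le_bneg_bneg a).trans_eq (bneg_bneg a))

theorem eq_bot_of_bneg_eq_top {a : α} (h : bneg a = ⊤) : a = ⊥ := by
  simpa [h] using inf_bneg a

theorem bneg_sup_kneg_bneg (a : α) : bneg a ⊔ kneg (bneg a) = ⊤ := by
  have h := congrArg kneg (inf_bneg (bneg a))
  rw [kneg_inf, bneg_bneg, kneg_kneg, kneg_bot] at h
  rwa [sup_comm]

end Basic

/-! ### Homomorphisms and subalgebras. -/

theorem IsHom.comp {α β γ : Type u} [BZLattice α] [BZLattice β] [BZLattice γ]
    {g : β → γ} {f : α → β} (hg : IsHom g) (hf : IsHom f) : IsHom (g ∘ f) where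
  map_inf a b := by simp [hf.map_inf, hg.map_inf]
  map_sup a b := by simp [hf.map_sup, hg.map_sup]
  map_kneg a := by simp [hf.map_kneg, hg.map_kneg]
  map_bneg a := by simp [hf.map_bneg, hg.map_bneg]
  map_bot := by simp [hf.map_bot, hg.map_bot]
  map_top := by simp [hf.map_top, hg.map_top]

theorem IsHom.id (α : Type u) [BZLattice α] : IsHom (_root_.id : α → α) where
  map_inf _ _ := rfl
  map_sup _ _ := rfl
  map_kneg _ := rfl
  map_bneg _ := rfl
  map_bot := rfl
  map_top := rfl

/-- A map into a product is a homomorphism when all its components are. -/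
theorem IsHom.pi {α : Type u} [BZLattice α] {ι : Type u} {A : ι → Type u} [∀ i, BZLattice (A i)]
    {f : ∀ i, α → A i} (hf : ∀ i, IsHom (f i)) : IsHom (fun a i => f i a) where
  map_inf a b := funext fun i => (hf i).map_inf a b
  map_sup a b := funext fun i => (hf i).map_sup a b
  map_kneg a := funext fun i => (hf i).map_kneg a
  map_bneg a := funext fun i => (hf i).map_bneg a
  map_bot := funext fun i => (hf i).map_bot
  map_top := funext fun i => (hf i).map_top

theorem isHom_eval {ι : Type u} (A : ι → Type u) [∀ i, BZLattice (A i)] (i : ι) :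
    IsHom (fun a : ∀ i, A i => a i) where
  map_inf _ _ := rfl
  map_sup _ _ := rfl
  map_kneg _ := rfl
  map_bneg _ := rfl
  map_bot := rfl
  map_top := rfl

section Subalgebra

/-- Closure of a set under the operations of a BZ-lattice. -/
structure IsSubalgebra {α : Type u} [BZLattice α] (s : Set α) : Prop where
  inf_mem : ∀ {a b}, a ∈ s → b ∈ s → a ⊓ b ∈ s
  sup_mem : ∀ {a b}, a ∈ s → b ∈ s → a ⊔ b ∈ s
  kneg_mem : ∀ {a}, a ∈ s → kneg a ∈ s
  bneg_mem : ∀ {a}, a ∈ s → bneg a ∈ s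
  bot_mem : ⊥ ∈ s
  top_mem : ⊤ ∈ s

/-- A subalgebra of a BZ-lattice as a BZ-lattice. -/
@[reducible] def IsSubalgebra.bzLattice {α : Type u} [BZLattice α] {s : Set α}
    (hs : IsSubalgebra s) : BZLattice s where
  toLattice := Subtype.lattice (fun _ _ => hs.sup_mem) (fun _ _ => hs.inf_mem)
  bot := ⟨⊥, hs.bot_mem⟩
  top := ⟨⊤, hs.top_mem⟩
  bot_le a := (bot_le : ⊥ ≤ a.1)
  le_top a := (le_top : a.1 ≤ ⊤)
  kneg a := ⟨kneg a.1, hs.kneg_mem a.2⟩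
  bneg a := ⟨bneg a.1, hs.bneg_mem a.2⟩
  kneg_antitone a b h := kneg_antitone a.1 b.1 h
  kneg_kneg a := Subtype.ext (kneg_kneg a.1)
  kleene a b := kleene a.1 b.1
  bneg_antitone a b h := bneg_antitone a.1 b.1 h
  inf_bneg a := Subtype.ext (inf_bneg a.1)
  le_bneg_bneg a := le_bneg_bneg a.1
  bneg_bneg a := Subtype.ext (bneg_bneg a.1)

end Subalgebra

/-! ### Class operators and generated varieties. -/

section Operators

theorem H_mono {K K' : Set BZL.{u}} (h : K ⊆ K') : H K ⊆ H K' :=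
  fun _ ⟨A, hA, f⟩ => ⟨A, h hA, f⟩

theorem S_mono {K K' : Set BZL.{u}} (h : K ⊆ K') : S K ⊆ S K' :=
  fun _ ⟨A, hA, f⟩ => ⟨A, h hA, f⟩

theorem P_mono {K K' : Set BZL.{u}} (h : K ⊆ K') : P K ⊆ P K' :=
  fun _ ⟨ι, A, hA, e⟩ => ⟨ι, A, fun i => h (hA i), e⟩

theorem H_H (K : Set BZL.{u}) : H (H K) ⊆ H K := by
  rintro C ⟨B, ⟨A, hA, f, hf, hfs⟩, g, hg, hgs⟩
  exact ⟨A, hA, g ∘ f, hg.comp hf, hgs.comp hfs⟩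

theorem S_S (K : Set BZL.{u}) : S (S K) ⊆ S K := by
  rintro C ⟨B, ⟨A, hA, f, hf, hfi⟩, g, hg, hgi⟩
  exact ⟨A, hA, f ∘ g, hf.comp hg, hfi.comp hgi⟩

theorem subset_H (K : Set BZL.{u}) : K ⊆ H K :=
  fun A hA => ⟨A, hA, id, IsHom.id A, Function.surjective_id⟩

/-- The preimage under `g` of the image of `f` is a subalgebra of `C`. Sending `c` to the unique `b`
with `f b = g c` maps it onto `B`. -/
theorem S_H (K : Set BZL.{u}) : S (H K) ⊆ H (S K) := by
  rintro B ⟨A, ⟨C, hC, g, hg, hgs⟩, f, hf, hfi⟩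
  have hs : IsSubalgebra {c : C | ∃ b : B, f b = g c} := by
    constructor
    · rintro a b ⟨x, hx⟩ ⟨y, hy⟩
      exact ⟨x ⊓ y, by rw [hf.map_inf, hg.map_inf, hx, hy]⟩
    · rintro a b ⟨x, hx⟩ ⟨y, hy⟩
      exact ⟨x ⊔ y, by rw [hf.map_sup, hg.map_sup, hx, hy]⟩
    · rintro a ⟨x, hx⟩
      exact ⟨kneg x, by rw [hf.map_kneg, hg.map_kneg, hx]⟩
    · rintro a ⟨x, hx⟩
      exact ⟨bneg x, by rw [hf.map_bneg, hg.map_bneg, hx]⟩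
    · exact ⟨⊥, by rw [hf.map_bot, hg.map_bot]⟩
    · exact ⟨⊤, by rw [hf.map_top, hg.map_top]⟩
  let := hs.bzLattice
  choose φ hφ using fun c : {c : C | ∃ b : B, f b = g c} => c.2
  refine ⟨BZL.mk {c : C | ∃ b : B, f b = g c},
    ⟨C, hC, Subtype.val, ?_, Subtype.val_injective⟩, φ, ?_, ?_⟩
  · constructor <;> intros <;> rfl
  · constructor
    · exact fun a b => hfi (by
        rw [hf.map_inf, hφ, hφ, hφ]; exact hg.map_inf a.1 b.1)
    · exact fun a b => hfi (by
        rw [hf.map_sup, hφ, hφ, hφ]; exact hg.map_sup a.1 b.1)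
    · exact fun a => hfi (by rw [hf.map_kneg, hφ, hφ]; exact hg.map_kneg a.1)
    · exact fun a => hfi (by rw [hf.map_bneg, hφ, hφ]; exact hg.map_bneg a.1)
    · exact hfi (by rw [hf.map_bot, hφ]; exact hg.map_bot)
    · exact hfi (by rw [hf.map_top, hφ]; exact hg.map_top)
  · intro b
    obtain ⟨c, hc⟩ := hgs (f b)
    exact ⟨⟨c, b, hc.symm⟩, hfi (by rw [hφ]; exact hc)⟩

theorem P_H (K : Set BZL.{u}) : P (H K) ⊆ H (P K) := by
  rintro B ⟨ι, A, hA, rfl⟩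
  choose C hC f hf hfs using hA
  refine ⟨BZL.mk (∀ i, C i), ⟨ι, C, hC, rfl⟩, fun c i => f i (c i), ?_, ?_⟩
  · exact IsHom.pi fun i => (hf i).comp (isHom_eval (fun i => C i) i)
  · intro b
    choose c hc using fun i => hfs i (b i)
    exact ⟨c, funext hc⟩

theorem P_S (K : Set BZL.{u}) : P (S K) ⊆ S (P K) := by
  rintro B ⟨ι, A, hA, rfl⟩
  choose C hC f hf hfi using hA
  refine ⟨BZL.mk (∀ i, C i), ⟨ι, C, hC, rfl⟩, fun c i => f i (c i), ?_, ?_⟩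
  · exact IsHom.pi fun i => (hf i).comp (isHom_eval (fun i => A i) i)
  · exact fun a b h => funext fun i => hfi i (congrFun h i)

/-- `P` is defined up to equality rather than isomorphism, so the currying isomorphism between an
iterated product and a product over a sigma type is absorbed by `S`. -/
theorem P_P (K : Set BZL.{u}) : P (P K) ⊆ S (P K) := by
  rintro B ⟨ι, A, hA, rfl⟩
  choose κ C hC e using hA
  obtain rfl : A = fun i => BZL.mk (∀ j, C i j) := funext e
  refine ⟨BZL.mk (∀ p : Σ i, κ i, C p.1 p.2), ⟨_, fun p : Σ i, κ i => C p.1 p.2,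
    fun p => hC p.1 p.2, rfl⟩, fun c p => c p.1 p.2, ?_, ?_⟩
  · constructor <;> intros <;> rfl
  · exact fun a b h => funext fun i => funext fun j => congrFun h ⟨i, j⟩

theorem isVariety_V (K : Set BZL.{u}) : IsVariety (V K) := by
  refine ⟨H_H _, (S_H _).trans (H_mono (S_S _)), (P_H _).trans (H_mono ?_)⟩
  exact (P_S _).trans ((S_mono (P_P _)).trans (S_S _))

theorem subset_V (K : Set BZL.{u}) : K ⊆ V K := by
  intro A hA
  refine subset_H _ ⟨BZL.mk (∀ _ : PUnit.{u + 1}, A), ⟨_, _, fun _ => hA, rfl⟩,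
    fun a _ => a, IsHom.pi fun _ => IsHom.id A, fun a b h => congrFun h PUnit.unit⟩

theorem IsVariety.V_subset {K W : Set BZL.{u}} (hW : IsVariety W) (h : K ⊆ W) : V K ⊆ W :=
  (H_mono ((S_mono ((P_mono h).trans hW.2.2)).trans hW.2.1)).trans hW.1

theorem V_mono {K K' : Set BZL.{u}} (h : K ⊆ K') : V K ⊆ V K' :=
  (isVariety_V K').V_subset (h.trans (subset_V K'))

theorem IsVariety.inter {K K' : Set BZL.{u}} (h : IsVariety K) (h' : IsVariety K') :
    IsVariety (K ∩ K') :=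
  ⟨Set.subset_inter ((H_mono Set.inter_subset_left).trans h.1)
      ((H_mono Set.inter_subset_right).trans h'.1),
    Set.subset_inter ((S_mono Set.inter_subset_left).trans h.2.1)
      ((S_mono Set.inter_subset_right).trans h'.2.1),
    Set.subset_inter ((P_mono Set.inter_subset_left).trans h.2.2)
      ((P_mono Set.inter_subset_right).trans h'.2.2)⟩

/-- A variety contains every algebra whose points are separated by homomorphisms into it. -/
theorem IsVariety.mem_of_separating {W : Set BZL.{u}} (hW : IsVariety W) {A : BZL.{u}}
    (h : ∀ a b : A, a ≠ b → ∃ B ∈ W, ∃ f : A → B, IsHom f ∧ f a ≠ f b) : A ∈ W := by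
  choose B hB f hf hne using fun p : {p : A × A // p.1 ≠ p.2} => h p.1.1 p.1.2 p.2
  refine hW.2.1 ⟨BZL.mk (∀ p, B p), hW.2.2 ⟨_, B, hB, rfl⟩, fun a p => f p a, IsHom.pi hf, ?_⟩
  intro a b hab
  by_contra hne'
  exact hne ⟨(a, b), hne'⟩ (congrFun hab _)

end Operators

/-! ### Identities and the varieties they define. -/

section Identities

/-- Terms in the language of BZ-lattices. -/
inductive BZTerm : Type
  | var : ℕ → BZTerm
  | inf : BZTerm → BZTerm → BZTerm
  | sup : BZTerm → BZTerm → BZTerm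
  | kneg : BZTerm → BZTerm
  | bneg : BZTerm → BZTerm

/-- The value of a term under an assignment of its variables. -/
def BZTerm.eval {α : Type u} [BZLattice α] (v : ℕ → α) : BZTerm → α
  | var n => v n
  | inf s t => s.eval v ⊓ t.eval v
  | sup s t => s.eval v ⊔ t.eval v
  | kneg s => BZLattice.kneg (s.eval v)
  | bneg s => BZLattice.bneg (s.eval v)

theorem IsHom.map_eval {α β : Type u} [BZLattice α] [BZLattice β] {f : α → β} (hf : IsHom f)
    (v : ℕ → α) (t : BZTerm) : f (t.eval v) = t.eval (f ∘ v) := by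
  induction t with
  | var n => rfl
  | inf s t hs ht => simp only [BZTerm.eval, hf.map_inf, hs, ht]
  | sup s t hs ht => simp only [BZTerm.eval, hf.map_sup, hs, ht]
  | kneg s hs => simp only [BZTerm.eval, hf.map_kneg, hs]
  | bneg s hs => simp only [BZTerm.eval, hf.map_bneg, hs]

/-- The class of BZ-lattices satisfying the identity `s = t`. -/
def models (s t : BZTerm) : Set BZL.{u} := {A | ∀ v : ℕ → A, s.eval v = t.eval v}

theorem isVariety_models (s t : BZTerm) : IsVariety (models.{u} s t) := by
  refine ⟨?_, ?_, ?_⟩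
  · rintro B ⟨A, hA, f, hf, hfs⟩ v
    choose w hw using fun n => hfs (v n)
    obtain rfl : f ∘ w = v := funext hw
    rw [← hf.map_eval, ← hf.map_eval, hA]
  · rintro B ⟨A, hA, f, hf, hfi⟩ v
    exact hfi (by rw [hf.map_eval, hf.map_eval, hA])
  · rintro B ⟨ι, A, hA, rfl⟩ v
    refine funext fun i => ?_
    have h := isHom_eval (fun i => A i) i
    exact (h.map_eval v s).trans ((hA i _).trans (h.map_eval v t).symm)

/-- The assignment `x, y, z, z, …` of the variables. -/
def assign {α : Type u} (x y z : α) : ℕ → α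
  | 0 => x
  | 1 => y
  | _ => z

open BZTerm

/-- The elements `bneg y` behave as central elements: meeting with `bneg y` is compatible with
all operations, and every `x` is recovered from its meets with `bneg y` and `bneg (bneg y)`. -/
structure BnegCentral (A : BZL.{u}) : Prop where
  sup_inf : ∀ x y z : A, (x ⊔ z) ⊓ bneg y = (x ⊓ bneg y) ⊔ (z ⊓ bneg y)
  kneg_inf_bneg : ∀ x y : A, kneg (x ⊓ bneg y) ⊓ bneg y = kneg x ⊓ bneg y
  bneg_inf_bneg : ∀ x y : A, bneg (x ⊓ bneg y) ⊓ bneg y = bneg x ⊓ bneg y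
  decomp : ∀ x y : A, (x ⊓ bneg y) ⊔ (x ⊓ bneg (bneg y)) = x

theorem isVariety_bnegCentral : IsVariety {A : BZL.{u} | BnegCentral A} := by
  have key : {A : BZL.{u} | BnegCentral A} =
      models (inf (sup (var 0) (var 2)) (bneg (var 1)))
        (sup (inf (var 0) (bneg (var 1))) (inf (var 2) (bneg (var 1)))) ∩
      models (inf (kneg (inf (var 0) (bneg (var 1)))) (bneg (var 1)))
        (inf (kneg (var 0)) (bneg (var 1))) ∩
      models (inf (bneg (inf (var 0) (bneg (var 1)))) (bneg (var 1)))
        (inf (bneg (var 0)) (bneg (var 1))) ∩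
      models (sup (inf (var 0) (bneg (var 1))) (inf (var 0) (bneg (bneg (var 1))))) (var 0) := by
    ext A
    constructor
    · intro h
      exact ⟨⟨⟨fun v => h.sup_inf _ _ _, fun v => h.kneg_inf_bneg _ _⟩,
        fun v => h.bneg_inf_bneg _ _⟩, fun v => h.decomp _ _⟩
    · rintro ⟨⟨⟨h1, h2⟩, h3⟩, h4⟩
      exact ⟨fun x y z => h1 (assign x y z), fun x y => h2 (assign x y y),
        fun x y => h3 (assign x y y), fun x y => h4 (assign x y y)⟩
  rw [key]
  exact (((isVariety_models _ _).inter (isVariety_models _ _)).inter (isVariety_models _ _)).inter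
    (isVariety_models _ _)

end Identities

/-! ### Quotients, maximal separating congruences, and splitting by `bneg y`. -/

section Congruences

/-- Congruences of a BZ-lattice. -/
structure Congruence (α : Type u) [BZLattice α] extends Setoid α where
  inf : ∀ {a b c d}, r a b → r c d → r (a ⊓ c) (b ⊓ d)
  sup : ∀ {a b c d}, r a b → r c d → r (a ⊔ c) (b ⊔ d)
  kneg : ∀ {a b}, r a b → r (kneg a) (kneg b)
  bneg : ∀ {a b}, r a b → r (bneg a) (bneg b)

namespace Congruence

variable {α : Type u} [BZLattice α] (c : Congruence α)

/-- The quotient of a BZ-lattice by a congruence. -/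
def Quot : Type u := Quotient c.toSetoid

/-- The class of an element modulo a congruence. -/
def proj (a : α) : c.Quot := Quotient.mk c.toSetoid a

variable {c} in
theorem proj_eq_iff {a b : α} : c.proj a = c.proj b ↔ c.r a b := Quotient.eq

theorem proj_surjective : Function.Surjective c.proj := Quotient.mk_surjective

/-- The lattice operations on a quotient. -/
@[reducible] def lattice : Lattice c.Quot :=
  letI : Max c.Quot := ⟨Quotient.map₂ (· ⊔ ·) fun _ _ h _ _ h' => c.sup h h'⟩
  letI : Min c.Quot := ⟨Quotient.map₂ (· ⊓ ·) fun _ _ h _ _ h' => c.inf h h'⟩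
  Lattice.mk'
    (by rintro ⟨a⟩ ⟨b⟩; exact congrArg c.proj (sup_comm a b))
    (by rintro ⟨a⟩ ⟨b⟩ ⟨d⟩; exact congrArg c.proj (sup_assoc a b d))
    (by rintro ⟨a⟩ ⟨b⟩; exact congrArg c.proj (inf_comm a b))
    (by rintro ⟨a⟩ ⟨b⟩ ⟨d⟩; exact congrArg c.proj (inf_assoc a b d))
    (by rintro ⟨a⟩ ⟨b⟩; exact congrArg c.proj (sup_inf_self (a := a) (b := b)))
    (by rintro ⟨a⟩ ⟨b⟩; exact congrArg c.proj (inf_sup_self (a := a) (b := b)))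

instance : Lattice c.Quot := c.lattice

theorem proj_sup (a b : α) : c.proj (a ⊔ b) = c.proj a ⊔ c.proj b := rfl

theorem proj_mono {a b : α} (h : a ≤ b) : c.proj a ≤ c.proj b := by
  rw [← sup_eq_right, ← proj_sup, sup_eq_right.mpr h]

theorem exists_le_of_proj_le {x y : c.Quot} (h : x ≤ y) :
    ∃ a b, a ≤ b ∧ c.proj a = x ∧ c.proj b = y := by
  obtain ⟨a, rfl⟩ := c.proj_surjective x
  obtain ⟨b, rfl⟩ := c.proj_surjective y
  exact ⟨a, a ⊔ b, le_sup_left, rfl, (c.proj_sup a b).trans (sup_eq_right.mpr h)⟩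

instance : BZLattice c.Quot where
  bot := c.proj ⊥
  top := c.proj ⊤
  bot_le := by rintro ⟨a⟩; exact c.proj_mono bot_le
  le_top := by rintro ⟨a⟩; exact c.proj_mono le_top
  kneg := Quotient.map BZLattice.kneg fun _ _ h => c.kneg h
  bneg := Quotient.map BZLattice.bneg fun _ _ h => c.bneg h
  kneg_antitone x y h := by
    obtain ⟨a, b, hab, rfl, rfl⟩ := c.exists_le_of_proj_le h
    exact c.proj_mono (kneg_antitone a b hab)
  kneg_kneg := by rintro ⟨a⟩; exact congrArg c.proj (kneg_kneg a)
  kleene := by rintro ⟨a⟩ ⟨b⟩; exact c.proj_mono (kleene a b)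
  bneg_antitone x y h := by
    obtain ⟨a, b, hab, rfl, rfl⟩ := c.exists_le_of_proj_le h
    exact c.proj_mono (bneg_antitone a b hab)
  inf_bneg := by rintro ⟨a⟩; exact congrArg c.proj (inf_bneg a)
  le_bneg_bneg := by rintro ⟨a⟩; exact c.proj_mono (le_bneg_bneg a)
  bneg_bneg := by rintro ⟨a⟩; exact congrArg c.proj (bneg_bneg a)

theorem isHom_proj : IsHom c.proj := by
  constructor <;> intros <;> rfl

/-- The identity congruence. -/
def identity (α : Type u) [BZLattice α] : Congruence α where
  r := Eq
  iseqv := eq_equivalence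
  inf := by rintro _ _ _ _ rfl rfl; rfl
  sup := by rintro _ _ _ _ rfl rfl; rfl
  kneg := by rintro _ _ rfl; rfl
  bneg := by rintro _ _ rfl; rfl

instance : PartialOrder (Congruence α) :=
  PartialOrder.lift (fun c => c.r) (by
    rintro ⟨⟨r, _⟩, _⟩ ⟨⟨r', _⟩, _⟩ h
    cases h
    rfl)

/-- The union of a nonempty chain of congruences. -/
def sUnion (C : Set (Congruence α)) (hC : IsChain (· ≤ ·) C) (hne : C.Nonempty) :
    Congruence α :=
  -- In a chain, any two related pairs are already related by a single member.
  have dir : ∀ {a b c d : α}, (∃ s ∈ C, s.r a b) → (∃ s ∈ C, s.r c d) →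
      ∃ s ∈ C, s.r a b ∧ s.r c d := by
    rintro a b c d ⟨s, hs, h⟩ ⟨t, ht, h'⟩
    rcases hC.total hs ht with hst | hst
    · exact ⟨t, ht, hst _ _ h, h'⟩
    · exact ⟨s, hs, h, hst _ _ h'⟩
  { r := fun a b => ∃ s ∈ C, s.r a b
    iseqv :=
      ⟨fun a => hne.imp fun s hs => ⟨hs, s.iseqv.refl a⟩,
        fun ⟨s, hs, h⟩ => ⟨s, hs, s.iseqv.symm h⟩,
        fun h h' => (dir h h').imp fun s hs => ⟨hs.1, s.iseqv.trans hs.2.1 hs.2.2⟩⟩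
    inf := fun h h' => (dir h h').imp fun s hs => ⟨hs.1, s.inf hs.2.1 hs.2.2⟩
    sup := fun h h' => (dir h h').imp fun s hs => ⟨hs.1, s.sup hs.2.1 hs.2.2⟩
    kneg := fun ⟨s, hs, h⟩ => ⟨s, hs, s.kneg h⟩
    bneg := fun ⟨s, hs, h⟩ => ⟨s, hs, s.bneg h⟩ }

/-- Distinct elements are separated by a congruence that is maximal with this property. -/
theorem exists_maximal_not_rel {a b : α} (hab : a ≠ b) :
    ∃ c : Congruence α, Maximal (fun c => ¬ c.r a b) c := by
  refine (zorn_le_nonempty₀ {c : Congruence α | ¬ c.r a b} ?_ (identity α) hab).imp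
    fun c hc => hc.2
  intro C hCs hC s hs
  refine ⟨sUnion C hC ⟨s, hs⟩, ?_, fun t ht x y h => ⟨t, ht, h⟩⟩
  rintro ⟨t, ht, h⟩
  exact hCs ht h

end Congruence

/-- The congruence obtained from `c` by also identifying elements with the same meet with
`bneg y`. -/
def BnegCentral.relativize {A : BZL.{u}} (hA : BnegCentral A) (c : Congruence A) (y : A) :
    Congruence A where
  r a b := c.r (a ⊓ bneg y) (b ⊓ bneg y)
  iseqv := ⟨fun _ => c.iseqv.refl _, c.iseqv.symm, c.iseqv.trans⟩
  inf {a b d e} h h' := by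
    rw [inf_inf_distrib_right a, inf_inf_distrib_right b]
    exact c.inf h h'
  sup {a b d e} h h' := by
    rw [hA.sup_inf, hA.sup_inf]
    exact c.sup h h'
  kneg {a b} h := by
    -- After rewriting, each side depends only on the meet of `a` or `b` with `bneg y`.
    rw [← hA.kneg_inf_bneg a, ← hA.kneg_inf_bneg b]
    exact c.inf (c.kneg h) (c.iseqv.refl _)
  bneg {a b} h := by
    rw [← hA.bneg_inf_bneg a, ← hA.bneg_inf_bneg b]
    exact c.inf (c.bneg h) (c.iseqv.refl _)

theorem BnegCentral.le_relativize {A : BZL.{u}} (hA : BnegCentral A) (c : Congruence A) (y : A) :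
    c ≤ hA.relativize c y :=
  fun _ _ h => c.inf h (c.iseqv.refl _)

/-- Distinct elements are separated by a quotient in which all Brouwer complements are trivial. -/
theorem BnegCentral.exists_congruence {A : BZL.{u}} (hA : BnegCentral A) {a b : A} (hab : a ≠ b) :
    ∃ c : Congruence A, ¬ c.r a b ∧ ∀ x : c.Quot, bneg x = ⊥ ∨ bneg x = ⊤ := by
  obtain ⟨c, hc⟩ := Congruence.exists_maximal_not_rel hab
  refine ⟨c, hc.prop, fun x => ?_⟩
  obtain ⟨y, rfl⟩ := c.proj_surjective x
  have key : ∀ z : A, ¬ (hA.relativize c z).r a b → bneg (c.proj z) = ⊤ := by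
    intro z hz
    -- By maximality the relativized congruence lies below `c`. It identifies `bneg z` with `⊤`,
    -- since both meet `bneg z` in `bneg z`.
    have h := hc.le_of_ge hz (hA.le_relativize c z) (bneg z) ⊤ (by
      change c.r _ _
      rw [inf_idem, top_inf_eq])
    exact (c.isHom_proj.map_bneg z).symm.trans (Congruence.proj_eq_iff.mpr h)
  by_cases h : (hA.relativize c y).r a b
  · left
    -- Were `a` and `b` related on both pieces, joining the pieces would relate them under `c`.
    have h' : ¬ (hA.relativize c (bneg y)).r a b := by
      intro h'
      apply hc.prop
      have := c.sup h h'
      rwa [hA.decomp, hA.decomp] at this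
    have := key _ h'
    rw [c.isHom_proj.map_bneg] at this
    exact eq_bot_of_bneg_eq_top this
  · exact Or.inr (key y h)

end Congruences

/-! ### Antiortholattices and the varieties they determine. -/

section Antiortholattices

/-- Brouwer complements are always sharp, so here they are trivial, and `bneg x = ⊤` forces `x = ⊥`.
-/
theorem bneg_eq_bot_of_mem_AOL {L : BZL.{u}} (hL : L ∈ AOL) {x : L} (hx : x ≠ ⊥) :
    bneg x = ⊥ := by
  have h : bneg x ∈ sharp L := bneg_sup_kneg_bneg x
  rw [hL.2] at h
  rcases h with h | h
  · exact h
  · exact absurd (eq_bot_of_bneg_eq_top h) hx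

theorem bneg_eq_bot_or_top_of_mem_AOL {L : BZL.{u}} (hL : L ∈ AOL) (x : L) :
    bneg x = ⊥ ∨ bneg x = ⊤ := by
  by_cases hx : x = ⊥
  · exact Or.inr (by rw [hx, bneg_bot])
  · exact Or.inl (bneg_eq_bot_of_mem_AOL hL hx)

/-- A PBZ*-lattice whose Brouwer complements are trivial is an antiortholattice. -/
theorem mem_AOL_of_bneg {L : BZL.{u}} (hL : L ∈ PBZLStar)
    (h : ∀ x : L, bneg x = ⊥ ∨ bneg x = ⊤) : L ∈ AOL := by
  refine ⟨hL, Set.ext fun x => ⟨fun hx => ?_, ?_⟩⟩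
  · have hx : x ⊔ kneg x = ⊤ := hx
    have h0 : x ⊓ kneg x = ⊥ := kneg_injective (by
      rw [kneg_inf, kneg_kneg, sup_comm, hx, kneg_bot])
    -- For sharp `x` this identity reads `⊤ = bneg x ⊔ bneg (kneg x)`; as `bneg x` is trivial, one
    -- of the two joinands is `⊤`.
    have h1 := hL.2 x
    rw [h0, bneg_bot] at h1
    rcases h x with h2 | h2
    · rw [h2, bot_sup_eq] at h1
      have h3 := eq_bot_of_bneg_eq_top h1.symm
      exact Or.inr (kneg_injective (by rw [h3, kneg_top]))
    · exact Or.inl (eq_bot_of_bneg_eq_top h2)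
  · rintro (rfl | rfl)
    · change ⊥ ⊔ kneg (⊥ : L) = ⊤
      simp
    · change ⊤ ⊔ kneg (⊤ : L) = ⊤
      simp

theorem bnegCentral_of_mem_AOL {L : BZL.{u}} (hL : L ∈ AOL) : BnegCentral L := by
  constructor
  · intro x y z
    rcases bneg_eq_bot_or_top_of_mem_AOL hL y with h | h <;> simp [h]
  · intro x y
    rcases bneg_eq_bot_or_top_of_mem_AOL hL y with h | h <;> simp [h]
  · intro x y
    rcases bneg_eq_bot_or_top_of_mem_AOL hL y with h | h <;> simp [h]
  · intro x y
    rcases bneg_eq_bot_or_top_of_mem_AOL hL y with h | h <;> simp [h]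

theorem bnegCentral_of_mem_V_AOL {L : BZL.{u}} (hL : L ∈ V AOL) : BnegCentral L :=
  isVariety_bnegCentral.V_subset (fun _ => bnegCentral_of_mem_AOL) hL

/-- Varieties of PBZ*-lattices generated within `V AOL` are determined by their
antiortholattices. -/
theorem subset_of_inter_AOL_subset {W K : Set BZL.{u}} (hW : IsVariety W) (hWP : W ⊆ PBZLStar)
    (hWA : W ⊆ V AOL) (hK : IsVariety K) (h : W ∩ AOL ⊆ K) : W ⊆ K := by
  intro A hA
  refine hK.mem_of_separating fun a b hab => ?_
  obtain ⟨c, hc, hb⟩ := (bnegCentral_of_mem_V_AOL (hWA hA)).exists_congruence hab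
  have hQ : BZL.mk c.Quot ∈ W := hW.1 ⟨A, hA, c.proj, c.isHom_proj, c.proj_surjective⟩
  exact ⟨BZL.mk c.Quot, h ⟨hQ, mem_AOL_of_bneg (hWP hQ) hb⟩, c.proj, c.isHom_proj,
    fun h => hc (Congruence.proj_eq_iff.mp h)⟩

end Antiortholattices

/-! ### The chains `D 3` and `D 4`, and the dichotomy for antiortholattices. -/

section Chains

instance (n : ℕ) [NeZero n] : Fintype (D.{u} n) := inferInstanceAs (Fintype (ULift.{u} (Fin n)))

instance (n : ℕ) [NeZero n] : DecidableEq (D.{u} n) :=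
  inferInstanceAs (DecidableEq (ULift.{u} (Fin n)))

/-- The element of the `n`-element chain at height `i`. -/
def chainElt {n : ℕ} [NeZero n] (i : Fin n) : D.{u} n := ULift.up i

/-- Distributive BZ-lattices with the strong De Morgan law for the Brouwer complement. -/
structure DistribSDM (A : BZL.{u}) : Prop where
  inf_sup : ∀ x y z : A, x ⊓ (y ⊔ z) = (x ⊓ y) ⊔ (x ⊓ z)
  bneg_inf : ∀ x y : A, bneg (x ⊓ y) = bneg x ⊔ bneg y

open BZTerm in
theorem isVariety_distribSDM : IsVariety {A : BZL.{u} | DistribSDM A} := by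
  have key : {A : BZL.{u} | DistribSDM A} =
      models (inf (var 0) (sup (var 1) (var 2))) (sup (inf (var 0) (var 1)) (inf (var 0) (var 2))) ∩
      models (bneg (inf (var 0) (var 1))) (sup (bneg (var 0)) (bneg (var 1))) := by
    ext A
    constructor
    · intro h
      exact ⟨fun v => h.inf_sup _ _ _, fun v => h.bneg_inf _ _⟩
    · rintro ⟨h1, h2⟩
      exact ⟨fun x y z => h1 (assign x y z), fun x y => h2 (assign x y y)⟩
  rw [key]
  exact (isVariety_models _ _).inter (isVariety_models _ _)

/-- Paraorthomodularity is not stated as an identity, so it is derived from two identities that pass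
from `D 4` to all of `V {D 4}`. If `kneg a ⊓ b = ⊥`, then `bneg (kneg a) ⊔ bneg b = ⊤`; meeting with
`b` gives `b ≤ bneg (kneg a) ≤ a`. -/
theorem DistribSDM.mem_PBZLStar {A : BZL.{u}} (hA : DistribSDM A) : A ∈ PBZLStar := by
  refine ⟨fun a b hab h => le_antisymm hab ?_, fun a => hA.bneg_inf _ _⟩
  have h1 := hA.bneg_inf (kneg a) b
  rw [h, bneg_bot] at h1
  have h2 := hA.inf_sup b (bneg (kneg a)) (bneg b)
  rw [← h1, inf_top_eq, inf_bneg, sup_bot_eq] at h2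
  have h3 := bneg_le_kneg (kneg a)
  rw [kneg_kneg] at h3
  rw [h2]
  exact inf_le_right.trans h3

theorem distribSDM_D_four : DistribSDM (D.{u} 4) := ⟨by decide, by decide⟩

theorem V_D_four_subset_PBZLStar : V {D.{u} 4} ⊆ PBZLStar := fun _ hA =>
  (isVariety_distribSDM.V_subset (Set.singleton_subset_iff.mpr distribSDM_D_four) hA).mem_PBZLStar

theorem D_four_mem_AOL : D.{u} 4 ∈ AOL :=
  mem_AOL_of_bneg distribSDM_D_four.mem_PBZLStar (by decide)

theorem D_three_mem_V_D_four : D.{u} 3 ∈ V {D.{u} 4} := by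
  -- Collapsing the two middle elements respects both complements.
  let f : D.{u} 4 → D.{u} 3 := fun a => chainElt (![0, 1, 1, 2] a.down)
  refine (isVariety_V _).1 ⟨D 4, subset_V _ rfl, f, ?_, ?_⟩
  · constructor <;> decide
  · change ∀ b, ∃ a, f a = b
    decide

theorem D_four_notMem_V_D_three : D.{u} 4 ∉ V {D.{u} 3} := by
  intro h
  -- The identity says that `x ⊔ kneg x` collapses to `x ⊓ kneg x` unless the latter is `⊥`. It
  -- fails in `D 4` at the atom, where the left side is the coatom.
  have h3 : D.{u} 3 ∈ models
      (.inf (.sup (.var 0) (.kneg (.var 0))) (.bneg (.bneg (.inf (.var 0) (.kneg (.var 0))))))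
      (.inf (.var 0) (.kneg (.var 0))) := by
    have : ∀ x : D.{u} 3, (x ⊔ kneg x) ⊓ bneg (bneg (x ⊓ kneg x)) = x ⊓ kneg x := by decide
    exact fun v => this (v 0)
  have h4 := (isVariety_models _ _).V_subset (Set.singleton_subset_iff.mpr h3) h
  exact absurd (h4 fun _ => chainElt 1) (by decide)

/-- An element strictly below its Kleene complement generates a four-element chain. -/
theorem D_four_mem_of_lt {W : Set BZL.{u}} (hW : IsVariety W) {L : BZL.{u}} (hL : L ∈ AOL)
    (hLW : L ∈ W) {y : L} (h0 : y ≠ ⊥) (hy : y < kneg y) : D.{u} 4 ∈ W := by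
  have h1 : kneg y ≠ ⊥ := (bot_le.trans_lt hy).ne'
  have h2 : kneg y ≠ ⊤ := fun h => h0 (kneg_injective (by rw [h, kneg_bot]))
  have b1 := bneg_eq_bot_of_mem_AOL hL h0
  have b2 := bneg_eq_bot_of_mem_AOL hL h1
  let g : Fin 4 → L := ![⊥, y, kneg y, ⊤]
  have hg : StrictMono g := by
    refine Fin.strictMono_iff_lt_succ.mpr fun i => ?_
    fin_cases i
    · exact bot_lt_iff_ne_bot.mpr h0
    · exact hy
    · exact lt_top_iff_ne_top.mpr h2
  refine hW.2.1 ⟨L, hLW, fun a : D.{u} 4 => g a.down, ⟨fun a b => hg.monotone.map_inf a.down b.down,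
    fun a b => hg.monotone.map_sup a.down b.down, ?_, ?_, rfl, rfl⟩,
    fun a b h => ULift.ext _ _ (hg.injective h)⟩
  · rintro ⟨a⟩
    fin_cases a
    · exact kneg_bot.symm
    · rfl
    · exact (kneg_kneg y).symm
    · exact kneg_top.symm
  · rintro ⟨a⟩
    fin_cases a
    · exact bneg_bot.symm
    · exact b1.symm
    · exact b2.symm
    · exact bneg_top.symm

/-- In an antiortholattice without an element `y ≠ ⊥` strictly below its Kleene complement, every
nontrivial element is a fixed point of the Kleene complement. -/
theorem kneg_eq_self_of_mem_AOL {L : BZL.{u}} (hL : L ∈ AOL)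
    (h : ∀ y : L, y ≠ ⊥ → ¬ y < kneg y) {x : L} (h0 : x ≠ ⊥) (h1 : x ≠ ⊤) : kneg x = x := by
  -- The hypothesis is applied to `x ⊓ kneg x`: it is either `⊥`, making `x` sharp, or equal to `x ⊔
  -- kneg x`, making `x` a fixed point.
  have hle : x ⊓ kneg x ≤ kneg (x ⊓ kneg x) := by
    rw [kneg_inf, kneg_kneg]
    exact inf_le_right.trans le_sup_left
  by_cases hx : x ⊓ kneg x = ⊥
  · have : x ∈ sharp L := by
      change x ⊔ kneg x = ⊤
      rw [← kneg_bot, ← hx, kneg_inf, kneg_kneg, sup_comm]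
    rw [hL.2] at this
    exact (this.elim h0 h1).elim
  · have he := hle.eq_of_not_lt (h _ hx)
    rw [kneg_inf, kneg_kneg] at he
    exact le_antisymm (le_sup_left.trans (he.ge.trans inf_le_left))
      (le_sup_right.trans (he.ge.trans inf_le_right))

theorem mem_V_D_three {L : BZL.{u}} (hL : L ∈ AOL) (h : ∀ y : L, y ≠ ⊥ → ¬ y < kneg y) :
    L ∈ V {D.{u} 3} := by
  have km : kneg (chainElt 1 : D.{u} 3) = chainElt 1 := by decide
  have bm : bneg (chainElt 1 : D.{u} 3) = ⊥ := by decide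
  have d1 : (⊥ : D.{u} 3) ≠ ⊤ := by decide
  have d2 : (⊥ : D.{u} 3) ≠ chainElt 1 := by decide
  have d3 : (⊤ : D.{u} 3) ≠ chainElt 1 := by decide
  classical
  have hV := isVariety_V {D.{u} 3}
  have hD : D.{u} 3 ∈ V {D.{u} 3} := subset_V _ rfl
  have hfix := fun x : L => kneg_eq_self_of_mem_AOL hL h (x := x)
  have huniq : ∀ x y : L, x ≠ ⊥ → x ≠ ⊤ → y ≠ ⊥ → y ≠ ⊤ → x = y := by
    have hle : ∀ x y : L, x ≠ ⊥ → x ≠ ⊤ → y ≠ ⊥ → y ≠ ⊤ → x ≤ y := by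
      intro x y hx hx' hy hy'
      -- For fixed points the Kleene inequality reduces to `x ≤ y`.
      simpa [hfix x hx hx', hfix y hy hy'] using kleene x y
    exact fun x y hx hx' hy hy' => le_antisymm (hle x y hx hx' hy hy') (hle y x hy hy' hx hx')
  -- The one-element algebra does not embed in `D 3`, as `⊥ ≠ ⊤` there; it is a quotient instead.
  by_cases hbt : (⊤ : L) = ⊥
  · have : Subsingleton L := subsingleton_of_bot_eq_top hbt.symm
    exact hV.1 ⟨_, hD, fun _ => ⊥, by constructor <;> intros <;> exact Subsingleton.elim _ _,
      fun _ => ⟨⊥, Subsingleton.elim _ _⟩⟩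
  have cases : ∀ x : L, x = ⊥ ∨ x = ⊤ ∨ (x ≠ ⊥ ∧ x ≠ ⊤ ∧ kneg x = x ∧ bneg x = ⊥) := by
    intro x
    by_cases h0 : x = ⊥
    · exact Or.inl h0
    by_cases h1 : x = ⊤
    · exact Or.inr (Or.inl h1)
    exact Or.inr (Or.inr ⟨h0, h1, hfix x h0 h1, bneg_eq_bot_of_mem_AOL hL h0⟩)
  let f : L → D.{u} 3 := fun x => if x = ⊥ then ⊥ else if x = ⊤ then ⊤ else chainElt 1
  have f0 : f ⊥ = ⊥ := if_pos rfl
  have f1 : f ⊤ = ⊤ := (if_neg hbt).trans (if_pos rfl)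
  have fm : ∀ {x}, x ≠ ⊥ → x ≠ ⊤ → f x = chainElt 1 := fun h h' => (if_neg h).trans (if_neg h')
  refine hV.2.1 ⟨_, hD, f, ⟨?_, ?_, ?_, ?_, f0, f1⟩, ?_⟩
  · intro a b
    rcases cases a with rfl | rfl | ⟨ha, ha', -⟩
    · simp [f0]
    · simp [f1]
    rcases cases b with rfl | rfl | ⟨hb, hb', -⟩
    · simp [f0]
    · simp [f1]
    obtain rfl := huniq a b ha ha' hb hb'
    simp
  · intro a b
    rcases cases a with rfl | rfl | ⟨ha, ha', -⟩
    · simp [f0]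
    · simp [f1]
    rcases cases b with rfl | rfl | ⟨hb, hb', -⟩
    · simp [f0]
    · simp [f1]
    obtain rfl := huniq a b ha ha' hb hb'
    simp
  · intro a
    rcases cases a with rfl | rfl | ⟨ha, ha', hk, hb⟩
    · simp [f0, f1]
    · simp [f0, f1]
    · rw [hk, fm ha ha', km]
  · intro a
    rcases cases a with rfl | rfl | ⟨ha, ha', hk, hb⟩
    · simp [f0, f1]
    · simp [f0, f1]
    · rw [hb, fm ha ha', bm, f0]
  · intro a b hab
    rcases cases a with rfl | rfl | ⟨ha, ha', -⟩ <;>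
      rcases cases b with rfl | rfl | ⟨hb, hb', -⟩
    · rfl
    · exact absurd (f0.symm.trans (hab.trans f1)) d1
    · exact absurd (f0.symm.trans (hab.trans (fm hb hb'))) d2
    · exact absurd (f0.symm.trans (hab.symm.trans f1)) d1
    · rfl
    · exact absurd (f1.symm.trans (hab.trans (fm hb hb'))) d3
    · exact absurd (f0.symm.trans (hab.symm.trans (fm ha ha'))) d2
    · exact absurd (f1.symm.trans (hab.symm.trans (fm ha ha'))) d3
    · exact huniq a b ha ha' hb hb'

/-- A variety of PBZ*-lattices within `V AOL` not included in `V {D 3}` contains `D 4`. -/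
theorem D_four_mem_of_not_subset {W : Set BZL.{u}} (hW : IsVariety W) (hWP : W ⊆ PBZLStar)
    (hWA : W ⊆ V AOL) (h : ¬ W ⊆ V {D.{u} 3}) : D.{u} 4 ∈ W := by
  by_contra hD
  refine h (subset_of_inter_AOL_subset hW hWP hWA (isVariety_V _) ?_)
  rintro L ⟨hLW, hL⟩
  exact mem_V_D_three hL fun y h0 hy => hD (D_four_mem_of_lt hW hL hLW h0 hy)

end Chains

end PBZ

/-! ### The unique cover. -/

theorem mainTheorem2 :
    ∃ V₃ V₄ : PBZ.Subvar PBZ.PBZLStar.{u},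
      (V₃ : Set PBZ.BZL.{u}) = PBZ.V {PBZ.D 3} ∧
      (V₄ : Set PBZ.BZL.{u}) = PBZ.V {PBZ.D 4} ∧
      {W : PBZ.Subvar PBZ.PBZLStar.{u} |
        V₃ ⋖ W ∧ (W : Set PBZ.BZL.{u}) ⊆ PBZ.V PBZ.AOL} = {V₄} := by
  have h34 : PBZ.V {PBZ.D.{u} 3} ⊆ PBZ.V {PBZ.D.{u} 4} :=
    (PBZ.isVariety_V _).V_subset (Set.singleton_subset_iff.mpr PBZ.D_three_mem_V_D_four)
  have h4A : PBZ.V {PBZ.D.{u} 4} ⊆ PBZ.V PBZ.AOL :=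
    PBZ.V_mono (Set.singleton_subset_iff.mpr PBZ.D_four_mem_AOL)
  let V₃ : PBZ.Subvar PBZ.PBZLStar.{u} :=
    ⟨PBZ.V {PBZ.D 3}, PBZ.isVariety_V _, h34.trans PBZ.V_D_four_subset_PBZLStar⟩
  let V₄ : PBZ.Subvar PBZ.PBZLStar.{u} :=
    ⟨PBZ.V {PBZ.D 4}, PBZ.isVariety_V _, PBZ.V_D_four_subset_PBZLStar⟩
  have hlt : V₃ < V₄ :=
    ⟨h34, fun h => PBZ.D_four_notMem_V_D_three (h (PBZ.subset_V _ rfl))⟩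
  have key : ∀ W : PBZ.Subvar PBZ.PBZLStar.{u}, V₃ < W →
      (W : Set PBZ.BZL.{u}) ⊆ PBZ.V PBZ.AOL → V₄ ≤ W := fun W hW hWA =>
    W.2.1.V_subset (Set.singleton_subset_iff.mpr
      (PBZ.D_four_mem_of_not_subset W.2.1 W.2.2 hWA hW.2))
  refine ⟨V₃, V₄, rfl, rfl, Set.eq_singleton_iff_unique_mem.mpr ⟨⟨⟨hlt, ?_⟩, h4A⟩, ?_⟩⟩
  · exact fun W h3 h4 => h4.not_ge (key W h3 (Set.Subset.trans h4.le h4A))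
  · rintro W ⟨hc, hWA⟩
    exact ((hc.eq_or_eq hlt.le (key W hc.lt hWA)).resolve_left hlt.ne').symm
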